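/- **Formulas.** Fix sets $\mathrm{Prop}$ of proposition symbols and $\mathrm{Var}$ of variable symbols. The $\mu$-formulas are given by $\varphi := P \mid X \mid \bot \mid \top \mid \neg\varphi \mid \varphi\land\varphi \mid \varphi\lor\varphi \mid \varphi\to\varphi \mid \Box\varphi \mid \Diamond\varphi \mid \mu X.\varphi \mid \nu X.\varphi$, where $\mu X.\varphi$ and $\nu X.\varphi$ are allowed only if $X$ is positive in $\varphi$. Here positivity and negativity are defined by structural induction: $X$ is both positive and negative in $P$, $\bot$, $\top$, in every variable $Y\ne X$, and in $\mu X.\varphi$, $\nu X.\varphi$; $X$ is positive (and not negative) in $X$; $\neg$ and the left side of $\to$ exchange positive and negative; all other connectives, the modalities, and $\mu Y,\nu Y$ with $Y\neq X$ preserve them. $\mathrm{Sub}(\varphi)$ is the set of subformulas of $\varphi$ (including $\varphi$), and $\eta$ stands for $\mu$ or $\nu$. A formula $\varphi$ is *well-named* if (i) for all $\eta X.\psi\in\mathrm{Sub}(\varphi)$, every occurrence of $X$ in $\psi$ is in the scope of some $\Box$ or $\Diamond$, and (ii) every variable $X$ that has a bound occurrence in $\varphi$ occurs only once in $\varphi$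 (the $X$ in $\eta X$ is not counted), and $\varphi$ contains only one fixed-point operator $\mu X$ or $\nu X$ for this $X$. **Models.** A $\mathsf{CK}$-model is $M=\langle W,W^\bot,\preceq,R,V\rangle$ with $W^\bot\subseteq W$, $\preceq$ a reflexive transitive relation on $W$, $R$ a relation on $W$, and $V:\mathrm{Prop}\to\mathcal P(W)$, such that $w\preceq v$ and $w\in V(P)$ imply $v\in V(P)$; $W^\bot\subseteq V(P)$ for all $P$; and if $w\in W^\bot$ and ($w\preceq v$ or $wRv$), then $v\in W^\bot$. Variables with free occurrences in $\varphi$ are treated as proposition symbols: each such $X$ is given a value $V(X)\subseteq W$, which may be arbitrary. **Game.** Let $w\in W$ and let $\varphi$ be a well-named $\mu$-formula. The evaluation game $\mathcal G(M,w\models\varphi)$ is played by $\mathsf I$ and $\mathsf{II}$, who at any time hold different roles among $\mathsf V$ (Verifier) and $\mathsf R$ (Refuter). Positions are $\langle v,\psi,\mathsf Q\rangle$ with $v\in W$, $\psi\in\mathrm{Sub}(\varphi)$ (main positions), and $\langle\langle v\rangle,\psi,\mathsf Q\rangle$ for $\Diamond\psi\in\mathrm{Sub}(\varphi)$, $\langle[v],\psi,\mathsf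 Q\rangle$ for $\Box\psi\in\mathrm{Sub}(\varphi)$, $\langle v,\psi?\theta,\mathsf Q\rangle$ for $\psi\to\theta\in\mathrm{Sub}(\varphi)$ (auxiliary positions); $\mathsf Q$ is the current role of $\mathsf I$, and $\bar{\mathsf Q}$ denotes the other role. The initial position is $\langle w,\varphi,\mathsf V\rangle$. Ownership and moves: - a main position $\langle v,\psi,\mathsf Q\rangle$ with $v\in W^\bot$ is owned by $\mathsf R$ and has no moves; for all other main positions below, $v\notin W^\bot$; - $\langle v,P,\mathsf Q\rangle$, and $\langle v,X,\mathsf Q\rangle$ with $X$ free in $\varphi$: no moves; owned by $\mathsf R$ if $v\in V(P)$ (resp. $v\in V(X)$), and by $\mathsf V$ otherwise; $\langle v,\bot,\mathsf Q\rangle$ is owned by $\mathsf V$ and $\langle v,\top,\mathsf Q\rangle$ by $\mathsf R$, with no moves; - $\langle v,\psi\lor\theta,\mathsf Q\rangle$ (owned by $\mathsf V$) and $\langle v,\psi\land\theta,\mathsf Q\rangle$ (owned by $\mathsf R$): to $\langle v,\psi,\mathsf Q\rangle$ or $\langle v,\theta,\mathsf Q\rangle$; - $\langle v,\neg\psi,\mathsf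 Q\rangle$ (owned by $\mathsf R$): to any $\langle u,\psi,\bar{\mathsf Q}\rangle$ with $v\preceq u$; - $\langle v,\psi\to\theta,\mathsf Q\rangle$ (owned by $\mathsf R$): to any $\langle u,\psi?\theta,\mathsf Q\rangle$ with $v\preceq u$; $\langle v,\psi?\theta,\mathsf Q\rangle$ (owned by $\mathsf V$): to $\langle v,\psi,\bar{\mathsf Q}\rangle$ or $\langle v,\theta,\mathsf Q\rangle$; - $\langle v,\Diamond\psi,\mathsf Q\rangle$ (owned by $\mathsf R$): to any $\langle\langle u\rangle,\psi,\mathsf Q\rangle$ with $v\preceq u$; $\langle\langle v\rangle,\psi,\mathsf Q\rangle$ (owned by $\mathsf V$): to any $\langle u,\psi,\mathsf Q\rangle$ with $vRu$; - $\langle v,\Box\psi,\mathsf Q\rangle$ (owned by $\mathsf R$): to any $\langle[u],\psi,\mathsf Q\rangle$ with $v\preceq u$; $\langle[v],\psi,\mathsf Q\rangle$ (owned by $\mathsf R$): to any $\langle u,\psi,\mathsf Q\rangle$ with $vRu$; - $\langle v,\eta X.\psi,\mathsf Q\rangle$: to $\langle v,\psi,\mathsf Q\rangle$; and, if $X$ is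 not free in $\varphi$, $\langle v,X,\mathsf Q\rangle$: to $\langle v,\eta X.\psi,\mathsf Q\rangle$, where $\eta X.\psi\in\mathrm{Sub}(\varphi)$ is the formula whose operator binds $X$ (this move *regenerates* $\eta X.\psi$); both are owned by $\mathsf V$ if $\eta=\mu$ and by $\mathsf R$ if $\eta=\nu$. A run is a finite or infinite sequence of positions that starts at the initial position, respects the moves, and, if finite, ends in a position with no available move. A fixed-point formula $\eta X.\psi$ is owned by $\mathsf I$ if some position $\langle v,\eta X.\psi,\mathsf Q\rangle$ reachable from the initial position has $\mathsf Q=\mathsf V$ and $\eta=\nu$, or $\mathsf Q=\mathsf R$ and $\eta=\mu$; otherwise it is owned by $\mathsf{II}$. A finite run is lost by the owner of its last position. An infinite run is won by the owner of the outermost infinitely often regenerated fixed-point formula, that is, of the infinitely often regenerated formula $\eta X.\psi$ such that every infinitely often regenerated formula is in $\mathrm{Sub}(\eta X.\psi)$. A positional strategy for a player is a function that assigns to each position owned by that player, if some move is available there, the target of an available move. It is winning if the player wins every run in which all their moves are made according to it. **Theorem (determinacy of evaluation games).** For every $\mathsf{CK}$-model $M$, every world $w$ of $M$ and every well-named $\mu$-formula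 $\varphi$, exactly one of the players $\mathsf I$ and $\mathsf{II}$ has a positional winning strategy in $\mathcal G(M,w\models\varphi)$. -/

import Mathlib

open Filter

namespace ConstructiveMu

/-- The two fixed-point operators: `mu` (least) and `nu` (greatest). -/
inductive FixOp : Type
  | mu
  | nu

/-- Raw syntax of the constructive `μ`-calculus; the positivity requirement on `μX.φ` and `νX.φ`
is imposed separately, by `Formula.WellFormed`. -/
inductive Formula (Atom : Type*) (Var : Type*)
  | atom (P : Atom)
  | var (X : Var)
  | bot
  | top
  | neg (φ : Formula Atom Var)
  | conj (φ ψ : Formula Atom Var)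
  | disj (φ ψ : Formula Atom Var)
  | impl (φ ψ : Formula Atom Var)
  | box (φ : Formula Atom Var)
  | dia (φ : Formula Atom Var)
  | fix (η : FixOp) (X : Var) (φ : Formula Atom Var)

namespace Formula

variable {Atom Var : Type*}

/-- `Signed X true φ`: the variable `X` is positive in `φ`;
`Signed X false φ`: the variable `X` is negative in `φ`. -/
def Signed (X : Var) : Bool → Formula Atom Var → Prop
  | _, atom _ => True
  | s, var Y => Y ≠ X ∨ s = true
  | _, bot => True
  | _, top => True
  | s, neg φ => Signed X (!s) φ
  | s, conj φ ψ => Signed X s φ ∧ Signed X s ψ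
  | s, disj φ ψ => Signed X s φ ∧ Signed X s ψ
  | s, impl φ ψ => Signed X (!s) φ ∧ Signed X s ψ
  | s, box φ => Signed X s φ
  | s, dia φ => Signed X s φ
  | s, fix _ Y φ => Y = X ∨ Signed X s φ

/-- `X` is positive in `φ`. -/
def Positive (X : Var) (φ : Formula Atom Var) : Prop := Signed X true φ

/-- The set of subformulas of a formula (the formula itself included). -/
def sub : Formula Atom Var → Set (Formula Atom Var)
  | atom P => {atom P}
  | var X => {var X}
  | bot => {bot}
  | top => {top}
  | neg φ => insert (neg φ) (sub φ)
  | conj φ ψ => insert (conj φ ψ) (sub φ ∪ sub ψ)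
  | disj φ ψ => insert (disj φ ψ) (sub φ ∪ sub ψ)
  | impl φ ψ => insert (impl φ ψ) (sub φ ∪ sub ψ)
  | box φ => insert (box φ) (sub φ)
  | dia φ => insert (dia φ) (sub φ)
  | fix η X φ => insert (fix η X φ) (sub φ)

/-- The `μ`-formulas: `μX.ψ` and `νX.ψ` are only allowed when `X` is positive in `ψ`. -/
def WellFormed (φ : Formula Atom Var) : Prop :=
  ∀ η X ψ, fix η X ψ ∈ sub φ → Positive X ψ

open Classical in
/-- The number of occurrences of the variable `X` in `φ`, free or bound (the `X` which is written
next to a fixed-point operator is not an occurrence). -/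
noncomputable def occ (X : Var) : Formula Atom Var → ℕ
  | atom _ => 0
  | var Y => if Y = X then 1 else 0
  | bot => 0
  | top => 0
  | neg φ => occ X φ
  | conj φ ψ => occ X φ + occ X ψ
  | disj φ ψ => occ X φ + occ X ψ
  | impl φ ψ => occ X φ + occ X ψ
  | box φ => occ X φ
  | dia φ => occ X φ
  | fix _ _ φ => occ X φ

open Classical in
/-- The number of occurrences of the fixed-point operators `μX` and `νX` in `φ`. -/
noncomputable def binders (X : Var) : Formula Atom Var → ℕ
  | atom _ => 0
  | var _ => 0
  | bot => 0
  | top => 0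
  | neg φ => binders X φ
  | conj φ ψ => binders X φ + binders X ψ
  | disj φ ψ => binders X φ + binders X ψ
  | impl φ ψ => binders X φ + binders X ψ
  | box φ => binders X φ
  | dia φ => binders X φ
  | fix _ Y φ => (if Y = X then 1 else 0) + binders X φ

/-- `X` has a free occurrence in `φ`. -/
def FreeIn (X : Var) : Formula Atom Var → Prop
  | atom _ => False
  | var Y => Y = X
  | bot => False
  | top => False
  | neg φ => FreeIn X φ
  | conj φ ψ => FreeIn X φ ∨ FreeIn X ψ
  | disj φ ψ => FreeIn X φ ∨ FreeIn X ψ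
  | impl φ ψ => FreeIn X φ ∨ FreeIn X ψ
  | box φ => FreeIn X φ
  | dia φ => FreeIn X φ
  | fix _ Y φ => Y ≠ X ∧ FreeIn X φ

/-- `X` has a bound occurrence in `φ`, that is, an occurrence in the scope of some `ηX`. -/
def BoundIn (X : Var) (φ : Formula Atom Var) : Prop :=
  ∃ η ψ, fix η X ψ ∈ sub φ ∧ var X ∈ sub ψ

/-- Every occurrence of `X` in `φ` is in the scope of some modality. -/
def GuardedIn (X : Var) : Formula Atom Var → Prop
  | atom _ => True
  | var Y => Y ≠ X
  | bot => True
  | top => True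
  | neg φ => GuardedIn X φ
  | conj φ ψ => GuardedIn X φ ∧ GuardedIn X ψ
  | disj φ ψ => GuardedIn X φ ∧ GuardedIn X ψ
  | impl φ ψ => GuardedIn X φ ∧ GuardedIn X ψ
  | box _ => True
  | dia _ => True
  | fix _ _ φ => GuardedIn X φ

/-- A formula is guarded iff `X` is guarded in `ψ` for all its subformulas `ηX.ψ`. -/
def Guarded (φ : Formula Atom Var) : Prop :=
  ∀ η X ψ, fix η X ψ ∈ sub φ → GuardedIn X ψ

/-- A formula is well-bounded iff every variable occurring bound in it occurs only once and has
only one fixed-point operator. -/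
def WellBounded (φ : Formula Atom Var) : Prop :=
  ∀ X, BoundIn X φ → occ X φ = 1 ∧ binders X φ = 1

/-- A formula is well-named iff it is guarded and well-bounded. -/
def WellNamed (φ : Formula Atom Var) : Prop := Guarded φ ∧ WellBounded φ

end Formula

/-- A `CK`-model with set of worlds `W`. -/
structure CKModel (Atom : Type*) (W : Type*) where
  /-- the fallible worlds -/
  fallible : Set W
  /-- the intuitionistic relation -/
  le : W → W → Prop
  /-- the modal relation -/
  rel : W → W → Prop
  /-- the valuation -/
  val : Atom → Set W
  le_refl : ∀ w, le w w
  le_trans : ∀ u v w, le u v → le v w → le u w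
  val_mono : ∀ P w v, le w v → w ∈ val P → v ∈ val P
  fallible_subset_val : ∀ P, fallible ⊆ val P
  fallible_le : ∀ w v, w ∈ fallible → le w v → v ∈ fallible
  fallible_rel : ∀ w v, w ∈ fallible → rel w v → v ∈ fallible

/-- The players. -/
inductive Player : Type
  | I
  | II

/-- The other player. -/
def Player.other : Player → Player
  | I => II
  | II => I

/-- The roles: Verifier and Refuter. -/
inductive Role : Type
  | V
  | R

/-- The dual role. -/
def Role.dual : Role → Role
  | V => R
  | R => V

/-- Positions of evaluation games. The last component is the role currently held by player `I`. -/
inductive Position (Atom : Type*) (Var : Type*) (W : Type*)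
  /-- the main position `⟨v, ψ, Q⟩` -/
  | main (v : W) (ψ : Formula Atom Var) (Q : Role)
  /-- the auxiliary position `⟨⟨v⟩, ψ, Q⟩` -/
  | dia (v : W) (ψ : Formula Atom Var) (Q : Role)
  /-- the auxiliary position `⟨[v], ψ, Q⟩` -/
  | box (v : W) (ψ : Formula Atom Var) (Q : Role)
  /-- the auxiliary position `⟨v, θ?θ', Q⟩` -/
  | ask (v : W) (θ θ' : Formula Atom Var) (Q : Role)

/-- The data of the evaluation game `G(M, w ⊨ φ)`. Free variables of `φ` are treated as
proposition symbols, so they need values too, which are given by `assign`; the values of `assign`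
at variables which are not free in `φ` are never used. -/
structure EvalGame (Atom : Type*) (Var : Type*) (W : Type*) where
  /-- the model `M` -/
  model : CKModel Atom W
  /-- the valuation of free variables -/
  assign : Var → Set W
  /-- the world `w` -/
  world : W
  /-- the formula `φ` -/
  formula : Formula Atom Var

namespace EvalGame

variable {Atom Var W : Type*} (G : EvalGame Atom Var W)

/-- The initial position `⟨w, φ, V⟩`. -/
def init : Position Atom Var W := Position.main G.world G.formula Role.V

/-- The positions of the game, among all the expressions of type `Position`. -/
def IsPosition : Position Atom Var W → Prop
  | .main _ ψ _ => ψ ∈ G.formula.sub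
  | .dia _ ψ _ => Formula.dia ψ ∈ G.formula.sub
  | .box _ ψ _ => Formula.box ψ ∈ G.formula.sub
  | .ask _ θ θ' _ => Formula.impl θ θ' ∈ G.formula.sub

/-- `G.Move p q`: the owner of the position `p` can move to the position `q`. There are no moves
from main positions at fallible worlds, nor from atoms, `⊥`, `⊤` and free variables of `φ`. -/
inductive Move : Position Atom Var W → Position Atom Var W → Prop
  | disj_left (v ψ θ Q) : v ∉ G.model.fallible →
      Move (.main v (.disj ψ θ) Q) (.main v ψ Q)
  | disj_right (v ψ θ Q) : v ∉ G.model.fallible →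
      Move (.main v (.disj ψ θ) Q) (.main v θ Q)
  | conj_left (v ψ θ Q) : v ∉ G.model.fallible →
      Move (.main v (.conj ψ θ) Q) (.main v ψ Q)
  | conj_right (v ψ θ Q) : v ∉ G.model.fallible →
      Move (.main v (.conj ψ θ) Q) (.main v θ Q)
  | neg (v u ψ Q) : v ∉ G.model.fallible → G.model.le v u →
      Move (.main v (.neg ψ) Q) (.main u ψ Q.dual)
  | impl (v u ψ θ Q) : v ∉ G.model.fallible → G.model.le v u →
      Move (.main v (.impl ψ θ) Q) (.ask u ψ θ Q)
  | ask_left (v ψ θ Q) : Move (.ask v ψ θ Q) (.main v ψ Q.dual)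
  | ask_right (v ψ θ Q) : Move (.ask v ψ θ Q) (.main v θ Q)
  | dia (v u ψ Q) : v ∉ G.model.fallible → G.model.le v u →
      Move (.main v (.dia ψ) Q) (.dia u ψ Q)
  | dia_aux (v u ψ Q) : G.model.rel v u → Move (.dia v ψ Q) (.main u ψ Q)
  | box (v u ψ Q) : v ∉ G.model.fallible → G.model.le v u →
      Move (.main v (.box ψ) Q) (.box u ψ Q)
  | box_aux (v u ψ Q) : G.model.rel v u → Move (.box v ψ Q) (.main u ψ Q)
  | fix (v η X ψ Q) : v ∉ G.model.fallible →
      Move (.main v (.fix η X ψ) Q) (.main v ψ Q)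
  | regenerate (v η X ψ Q) : v ∉ G.model.fallible → ¬ G.formula.FreeIn X →
      Formula.fix η X ψ ∈ G.formula.sub →
      Move (.main v (.var X) Q) (.main v (.fix η X ψ) Q)

open Classical in
/-- The role owning a main position `⟨v, ψ, Q⟩` at a world `v` which is not fallible. -/
noncomputable def formulaRole (v : W) : Formula Atom Var → Role
  | .atom P => if v ∈ G.model.val P then .R else .V
  | .var X =>
      if G.formula.FreeIn X then (if v ∈ G.assign X then .R else .V)
      else if ∃ ψ, Formula.fix .nu X ψ ∈ G.formula.sub then .R else .V
  | .bot => .V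
  | .top => .R
  | .neg _ => .R
  | .conj _ _ => .R
  | .disj _ _ => .V
  | .impl _ _ => .R
  | .box _ => .R
  | .dia _ => .R
  | .fix .mu _ _ => .V
  | .fix .nu _ _ => .R

open Classical in
/-- The role owning a position. -/
noncomputable def ownerRole : Position Atom Var W → Role
  | .main v ψ _ => if v ∈ G.model.fallible then .R else G.formulaRole v ψ
  | .dia _ _ _ => .V
  | .box _ _ _ => .R
  | .ask _ _ _ _ => .V

/-- The player who has role `S` when player `I` has role `Q`. -/
def playerOf : (Q S : Role) → Player
  | .V, .V => .I
  | .R, .R => .I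
  | .V, .R => .II
  | .R, .V => .II

/-- The role of player `I` at a position. -/
def roleOfI : Position Atom Var W → Role
  | .main _ _ Q => Q
  | .dia _ _ Q => Q
  | .box _ _ Q => Q
  | .ask _ _ _ Q => Q

/-- The player owning a position. -/
noncomputable def owner (p : Position Atom Var W) : Player := playerOf (roleOfI p) (G.ownerRole p)

/-- `G.IsRun ρ N`: the sequence `ρ 0, ρ 1, …` is a run with last position `ρ N` (if `N` is finite)
or an infinite run (if `N = ⊤`). It starts at the initial position, respects the rules, and ends
only where no move is available. -/
def IsRun (ρ : ℕ → Position Atom Var W) (N : ℕ∞) : Prop :=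
  ρ 0 = G.init ∧ (∀ n : ℕ, (n : ℕ∞) < N → G.Move (ρ n) (ρ (n + 1))) ∧
    ∀ n : ℕ, N = n → ∀ q, ¬ G.Move (ρ n) q

/-- The positions reachable from the initial position. -/
def Reachable (p : Position Atom Var W) : Prop := Relation.ReflTransGen G.Move G.init p

/-- `G.OwnsFix A χ`: the fixed-point formula `χ` is owned by the player `A`. -/
def OwnsFix : Player → Formula Atom Var → Prop
  | .I, χ => ∃ v Q η X ψ, χ = Formula.fix η X ψ ∧ G.Reachable (.main v χ Q) ∧
      ((Q = Role.V ∧ η = FixOp.nu) ∨ (Q = Role.R ∧ η = FixOp.mu))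
  | .II, χ => ¬ ∃ v Q η X ψ, χ = Formula.fix η X ψ ∧ G.Reachable (.main v χ Q) ∧
      ((Q = Role.V ∧ η = FixOp.nu) ∨ (Q = Role.R ∧ η = FixOp.mu))

/-- The fixed-point formula `χ = ηX.ψ` is regenerated by the `n`-th move of `ρ`, that is, this is
a move from `⟨v, X, Q⟩` to `⟨v, ηX.ψ, Q⟩`. -/
def RegeneratedAt (ρ : ℕ → Position Atom Var W) (n : ℕ) (χ : Formula Atom Var) : Prop :=
  ∃ v Q η X ψ, χ = Formula.fix η X ψ ∧ ρ n = .main v (.var X) Q ∧ ρ (n + 1) = .main v χ Q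

/-- `χ` is regenerated infinitely often in `ρ`. -/
def RegeneratedInfOften (ρ : ℕ → Position Atom Var W) (χ : Formula Atom Var) : Prop :=
  ∃ᶠ n in atTop, RegeneratedAt ρ n χ

/-- `χ` is the outermost infinitely often regenerated fixed-point formula in `ρ`. -/
def Outermost (ρ : ℕ → Position Atom Var W) (χ : Formula Atom Var) : Prop :=
  RegeneratedInfOften ρ χ ∧ ∀ χ', RegeneratedInfOften ρ χ' → χ' ∈ χ.sub

/-- The player `A` wins the run `ρ` with last index `N`: a finite run is lost by the owner of its
last position; an infinite run is won by the owner of the outermost infinitely often regenerated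
fixed-point formula. -/
def Wins (A : Player) (ρ : ℕ → Position Atom Var W) (N : ℕ∞) : Prop :=
  (∃ n : ℕ, N = n ∧ G.owner (ρ n) = A.other) ∨
    (N = ⊤ ∧ ∃ χ, Outermost ρ χ ∧ G.OwnsFix A χ)

/-- `σ` is a positional strategy for the player `A`: at every position owned by `A` from which
some move is available, it gives an available move. -/
def IsStrategy (A : Player) (σ : Position Atom Var W → Position Atom Var W) : Prop :=
  ∀ p, G.IsPosition p → G.owner p = A → (∃ q, G.Move p q) → G.Move p (σ p)

/-- The player `A` follows `σ` in the run `ρ` with last index `N`. -/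
def Follows (A : Player) (σ : Position Atom Var W → Position Atom Var W)
    (ρ : ℕ → Position Atom Var W) (N : ℕ∞) : Prop :=
  ∀ n : ℕ, (n : ℕ∞) < N → G.owner (ρ n) = A → ρ (n + 1) = σ (ρ n)

/-- The player `A` has a positional winning strategy. -/
def HasPositionalWinningStrategy (A : Player) : Prop :=
  ∃ σ : Position Atom Var W → Position Atom Var W, G.IsStrategy A σ ∧
    ∀ ρ N, G.IsRun ρ N → G.Follows A σ ρ N → G.Wins A ρ N

end EvalGame

end ConstructiveMu

namespace ConstructiveMu

/-! The evaluation game is a parity game in disguise, and parity games with finitely many priorities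
are positionally determined on graphs of any size.

Dead ends become sinks won by the opponent of their owner. A position at a bound variable gets a
priority that grows with the size of the fixed-point formula regenerated there, and whose parity
names the owner of that formula. All moves but regenerations decrease a rank, so infinite runs
regenerate infinitely often. A bound variable occurs only once, so formulas containing it are
nested. Hence the largest priority seen infinitely often belongs to the outermost formula
regenerated infinitely often (`exists_outermost`).

Determinacy (`ParityGame.determined`) is an induction on the top priority `k`. Let `A` be the player
favoured by `k` and `L` the region where the opponent wins. Turn `L` into sinks lost by `A`, and the
other positions of priority `k` into sinks won by `A`; this game has fewer priorities. The opponent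
wins there only inside `L` (`winningRegion_cut_other_subset`), so by induction `A` wins it
everywhere else, and this lifts back to the original game (`mem_winningRegion_of_cut`). Both steps
need one strategy that wins on a whole region (`exists_uniform`).

At most one player can win, because two winning strategies played against each other produce a
single run won by both. -/

theorem Player.other_ne (A : Player) : A.other ≠ A := by cases A <;> simp [Player.other]

theorem Player.eq_other_of_ne {A B : Player} (h : A ≠ B) : A = B.other := by
  cases A <;> cases B <;> simp_all [Player.other]

/-! ### Parity games and uniform positional strategies -/

/-- Parity games on arbitrary graphs without dead ends. -/
structure ParityGame (P : Type*) where
  /-- the moves -/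
  edge : P → P → Prop
  /-- the owner of a position -/
  owner : P → Player
  /-- the priority of a position -/
  priority : P → ℕ
  exists_edge : ∀ p, ∃ q, edge p q

namespace ParityGame

variable {P : Type*} (G : ParityGame P)

/-- The player who likes the priority `k`. -/
def favours (k : ℕ) : Player := if k % 2 = 0 then .I else .II

/-- The smallest priority favouring a given player. -/
def code : Player → ℕ
  | .I => 0
  | .II => 1

theorem favours_code (A : Player) : favours (code A) = A := by cases A <;> rfl

theorem code_lt_two (A : Player) : code A < 2 := by cases A <;> decide

/-- `A` wins the infinite play `f`: the largest priority occurring infinitely often favours `A`. -/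
def WonBy (A : Player) (f : ℕ → P) : Prop :=
  ∃ k, favours k = A ∧ (∃ᶠ n in atTop, G.priority (f n) = k) ∧
    ∀ᶠ n in atTop, G.priority (f n) ≤ k

/-- `f` is an infinite play in which `A` follows `σ`. -/
def IsPlay (A : Player) (σ : P → P) (f : ℕ → P) : Prop :=
  ∀ n, G.edge (f n) (f (n + 1)) ∧ (G.owner (f n) = A → f (n + 1) = σ (f n))

/-- The positional strategy `σ` of `A` wins every play from `p`. -/
def WinsFrom (A : Player) (σ : P → P) (p : P) : Prop :=
  ∀ f : ℕ → P, f 0 = p → G.IsPlay A σ f → G.WonBy A f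

/-- The positions from which `A` wins with some positional strategy. -/
def winningRegion (A : Player) : Set P :=
  {p | ∃ σ : P → P, (∀ q, G.edge q (σ q)) ∧ G.WinsFrom A σ p}

variable {G} {A : Player} {σ : P → P}

theorem wonBy_shift (f : ℕ → P) (m : ℕ) : G.WonBy A (fun n => f (n + m)) ↔ G.WonBy A f := by
  unfold WonBy
  have h (q : ℕ → Prop) : (∀ᶠ n in atTop, q (n + m)) ↔ ∀ᶠ n in atTop, q n := by
    rw [← eventually_map (m := fun n => n + m), map_add_atTop_eq_nat]
  refine exists_congr fun k => and_congr_right fun _ => and_congr ?_ ?_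
  · rw [Filter.Frequently, Filter.Frequently, not_iff_not]
    exact h fun n => ¬ G.priority (f n) = k
  · exact h fun n => G.priority (f n) ≤ k

theorem IsPlay.shift {f : ℕ → P} (h : G.IsPlay A σ f) (m : ℕ) :
    G.IsPlay A σ (fun n => f (n + m)) := fun n => by
  simpa [add_right_comm] using h (n + m)

/-- Prefixing `p` to a play from `q` gives a play from `p`, and a finite prefix does not affect the
winner. -/
theorem WinsFrom.step {p q : P} (h : G.WinsFrom A σ p) (e : G.edge p q)
    (hσ : G.owner p = A → q = σ p) : G.WinsFrom A σ q := by
  intro f hf hp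
  refine (wonBy_shift (fun n => Nat.casesOn n p f : ℕ → P) 1).2 (h _ rfl ?_)
  rintro (_ | n)
  · simpa [hf] using ⟨e, hσ⟩
  · exact hp n

theorem WinsFrom.favours_of_sink {p : P} (h : G.WinsFrom A σ p) (hσ : ∀ q, G.edge q (σ q))
    (hp : ∀ q, G.edge p q → q = p) : favours (G.priority p) = A := by
  have e := hp _ (hσ p)
  have hpp := hσ p
  rw [e] at hpp
  obtain ⟨k, hk, hk', -⟩ := h (fun _ => p) rfl fun _ => ⟨hpp, fun _ => e.symm⟩
  obtain ⟨_, h'⟩ := hk'.exists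
  rwa [h']

variable (G A) in
-- Well-order all strategies and at each position follow the least one winning from there. Along a
-- play this least strategy never increases, because a winning strategy stays winning after a step
-- consistent with it. So it is eventually constant, and a tail of the play follows one winning
-- strategy.
theorem exists_uniform : ∃ σ : P → P, (∀ q, G.edge q (σ q)) ∧
    ∀ p ∈ G.winningRegion A, G.WinsFrom A σ p := by
  classical
  obtain ⟨_, wf⟩ := exists_wellFoundedLT (P → P)
  have hmin : ∀ p : P, ∃ σ : P → P, (∀ q, G.edge q (σ q)) ∧ (p ∈ G.winningRegion A →
      G.WinsFrom A σ p ∧ ∀ τ : P → P, (∀ q, G.edge q (τ q)) → G.WinsFrom A τ p → σ ≤ τ) := by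
    intro p
    by_cases hp : p ∈ G.winningRegion A
    · obtain ⟨σ, ⟨h1, h2⟩, h3⟩ := wf.wf.has_min
        {σ : P → P | (∀ q, G.edge q (σ q)) ∧ G.WinsFrom A σ p} hp
      exact ⟨σ, h1, fun _ => ⟨h2, fun τ a b => not_lt.1 (h3 τ ⟨a, b⟩)⟩⟩
    · choose τ hτ using G.exists_edge
      exact ⟨τ, hτ, fun h => absurd h hp⟩
  choose r hr hr' using hmin
  refine ⟨fun p => r p p, fun q => hr q q, fun p hp f h0 hf => ?_⟩
  have hmem : ∀ n, f n ∈ G.winningRegion A := by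
    intro n
    induction n with
    | zero => rwa [h0]
    | succ n ih => exact ⟨r (f n), hr _, (hr' _ ih).1.step (hf n).1 (hf n).2⟩
  have hanti : Antitone fun n => r (f n) := antitone_nat_of_succ_le fun n =>
    (hr' _ (hmem (n + 1))).2 _ (hr _) ((hr' _ (hmem n)).1.step (hf n).1 (hf n).2)
  obtain ⟨_, ⟨m, rfl⟩, hm⟩ := wf.wf.has_min (Set.range fun n => r (f n)) ⟨_, 0, rfl⟩
  have hconst : ∀ n, r (f (n + m)) = r (f m) := fun n =>
    le_antisymm (hanti (Nat.le_add_left m n)) (not_lt.1 (hm _ ⟨n + m, rfl⟩))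
  refine (wonBy_shift f m).1 ((hr' _ (hmem m)).1 _ (by simp) fun n => ⟨(hf.shift m n).1, fun h => ?_⟩)
  rw [← hconst n]
  exact (hf.shift m n).2 h

/-- If `p` were outside the region, redirecting the uniform strategy at `p` would do no harm: a play
that enters the region stays there and never meets `p` again. -/
theorem mem_winningRegion_of_edge {p q : P} (hp : G.owner p = A) (e : G.edge p q)
    (hq : q ∈ G.winningRegion A) : p ∈ G.winningRegion A := by
  classical
  by_contra hpW
  obtain ⟨σ, hσ, hW⟩ := G.exists_uniform A
  refine hpW ⟨Function.update σ p q, fun r => ?_, fun f h0 hf => ?_⟩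
  · by_cases h : r = p
    · subst h; simpa using e
    · simpa [h] using hσ r
  · have hne : ∀ r ∈ G.winningRegion A, r ≠ p := fun r hr h => hpW (h ▸ hr)
    have hmem : ∀ n, f (n + 1) ∈ G.winningRegion A := by
      intro n
      induction n with
      | zero =>
        have := (hf 0).2 (by rw [h0, hp])
        rw [h0, Function.update_self] at this
        rwa [this]
      | succ n ih =>
        refine ⟨σ, hσ, (hW _ ih).step (hf (n + 1)).1 fun h => ?_⟩
        rw [(hf (n + 1)).2 h, Function.update_of_ne (hne _ ih)]
    refine (wonBy_shift f 1).1 (hW _ (hmem 0) _ rfl fun n => ⟨(hf _).1, fun h => ?_⟩)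
    rw [(hf (n + 1)).2 h, Function.update_of_ne (hne _ (hmem n))]

/-- Whoever owns `p`, the uniform strategy wins from whichever successor is reached. -/
theorem mem_winningRegion_of_forall {p : P}
    (h : ∀ q, G.edge p q → q ∈ G.winningRegion A) : p ∈ G.winningRegion A := by
  obtain ⟨σ, hσ, hW⟩ := G.exists_uniform A
  exact ⟨σ, hσ, fun f h0 hf => (wonBy_shift f 1).1
    (hW _ (h _ (h0 ▸ (hf 0).1)) _ rfl (hf.shift 1))⟩

/-! ### Cutting off the top priority, and determinacy -/

variable (G) in
open Classical in
/-- The game `G` in which the positions in `L` and the other positions of priority `k` are turned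
into sinks, favouring `A.other` and `A`, respectively. -/
noncomputable def cut (A : Player) (L : Set P) (k : ℕ) : ParityGame P where
  edge p q := if p ∈ L ∨ G.priority p = k then q = p else G.edge p q
  owner := G.owner
  priority p := if p ∈ L then code A.other else if G.priority p = k then code A else G.priority p
  exists_edge p := by
    split_ifs
    · exact ⟨p, rfl⟩
    · exact G.exists_edge p

variable {L : Set P} {k : ℕ}

theorem cut_edge {p q : P} (hL : p ∉ L) (hk : G.priority p ≠ k) :
    (G.cut A L k).edge p q ↔ G.edge p q := by simp [cut, hL, hk]

theorem cut_priority {p : P} (hL : p ∉ L) (hk : G.priority p ≠ k) :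
    (G.cut A L k).priority p = G.priority p := by simp [cut, hL, hk]

theorem IsPlay.cut {B : Player} {f : ℕ → P} {τ : P → P} (hL : ∀ n, f n ∉ L)
    (hk : ∀ n, G.priority (f n) ≠ k) (hf : ∀ n, G.edge (f n) (f (n + 1)))
    (hτ : ∀ n, G.owner (f n) = B → f (n + 1) = τ (f n)) : (G.cut A L k).IsPlay B τ f :=
  fun n => ⟨(cut_edge (hL n) (hk n)).2 (hf n), hτ n⟩

theorem wonBy_cut {B : Player} {f : ℕ → P} (hL : ∀ n, f n ∉ L)
    (hk : ∀ n, G.priority (f n) ≠ k) : (G.cut A L k).WonBy B f ↔ G.WonBy B f := by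
  simp only [WonBy, cut_priority (hL _) (hk _)]

theorem WinsFrom.not_mem_cut {p : P} (h : (G.cut A L k).WinsFrom A σ p)
    (hσ : ∀ q, (G.cut A L k).edge q (σ q)) : p ∉ L := by
  intro hp
  have := h.favours_of_sink hσ (by simp [ParityGame.cut, hp])
  simp only [ParityGame.cut, hp, if_true, favours_code] at this
  exact A.other_ne this

theorem WinsFrom.priority_ne_of_cut {p : P} (h : (G.cut A L k).WinsFrom A.other σ p)
    (hσ : ∀ q, (G.cut A L k).edge q (σ q)) (hL : p ∉ L) : G.priority p ≠ k := by
  intro hp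
  have := h.favours_of_sink hσ (by simp [ParityGame.cut, hp])
  simp only [ParityGame.cut, hp, hL, if_true, if_false, favours_code] at this
  exact A.other_ne this.symm

/-- Follow the cut-game strategy until the play enters the true winning region, and the uniform
strategy from then on. A play that never enters it also never meets priority `k`, since there the
cut game has a sink lost by `A.other`; so it is a play of the cut game. -/
theorem winningRegion_cut_other_subset :
    (G.cut A (G.winningRegion A.other) k).winningRegion A.other ⊆ G.winningRegion A.other := by
  classical
  rintro p ⟨τ, hτ, hp⟩
  by_contra hpL
  obtain ⟨σ, hσ, hW⟩ := G.exists_uniform A.other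
  let ρ : P → P := fun q =>
    -- At priority `k` the strategy `τ` only follows the loop of the sink, which need not be an edge
    -- of `G`; `σ` serves as a legal filler.
    if q ∈ G.winningRegion A.other ∨ G.priority q = k then σ q else τ q
  refine hpL ⟨ρ, fun q => ?_, fun f h0 hf => ?_⟩
  · by_cases h : q ∈ G.winningRegion A.other ∨ G.priority q = k
    · simpa [ρ, h] using hσ q
    · have := hτ q
      rw [not_or] at h
      rw [cut_edge h.1 h.2] at this
      simpa [ρ, h] using this
  by_cases hL : ∃ m, f m ∈ G.winningRegion A.other
  · obtain ⟨m, hm⟩ := hL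
    have hstep : ∀ n, f n ∈ G.winningRegion A.other → G.owner (f n) = A.other →
        f (n + 1) = σ (f n) := fun n hn ho => by rw [(hf n).2 ho]; simp [ρ, hn]
    have hmem : ∀ n, f (n + m) ∈ G.winningRegion A.other := by
      intro n
      induction n with
      | zero => simpa using hm
      | succ n ih =>
        rw [add_right_comm]
        exact ⟨σ, hσ, (hW _ ih).step (hf _).1 (hstep _ ih)⟩
    refine (wonBy_shift f m).1 (hW _ hm _ (by simp) fun n => ⟨(hf.shift m n).1, fun ho => ?_⟩)
    simpa [add_right_comm] using hstep _ (hmem n) ho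
  · rw [not_exists] at hL
    have key : ∀ n, G.priority (f n) ≠ k → G.owner (f n) = A.other → f (n + 1) = τ (f n) :=
      fun n hn ho => by rw [(hf n).2 ho]; simp [ρ, hn, hL n]
    have hw : ∀ n, (G.cut A (G.winningRegion A.other) k).WinsFrom A.other τ (f n) := by
      intro n
      induction n with
      | zero => rwa [h0]
      | succ n ih =>
        have hk := ih.priority_ne_of_cut hτ (hL n)
        exact ih.step ((cut_edge (hL n) hk).2 (hf n).1) (key n hk)
    have hk := fun n => (hw n).priority_ne_of_cut hτ (hL n)
    exact (wonBy_cut hL hk).1 (hp f h0 (IsPlay.cut hL hk (fun n => (hf n).1) fun n => key n (hk n)))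

/-- `A` can avoid the opponent's region forever, playing the cut-game strategy away from priority
`k`. Either `k` recurs infinitely often and `A` wins as `k` is maximal, or some tail avoids `k` and
is a play of the cut game. -/
theorem mem_winningRegion_of_cut (hA : favours k = A) (hk : ∀ p, G.priority p ≤ k)
    (hcut : ∀ p, p ∉ G.winningRegion A.other →
      p ∈ (G.cut A (G.winningRegion A.other) k).winningRegion A)
    {p : P} (hp : p ∉ G.winningRegion A.other) : p ∈ G.winningRegion A := by
  classical
  obtain ⟨σ, hσ, hW⟩ := (G.cut A (G.winningRegion A.other) k).exists_uniform A
  have hτ : ∀ q, ∃ r, G.edge q r ∧ (q ∉ G.winningRegion A.other → G.owner q = A →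
      (G.priority q = k → r ∉ G.winningRegion A.other) ∧ (G.priority q ≠ k → r = σ q)) := by
    intro q
    by_cases hq : q ∉ G.winningRegion A.other ∧ G.owner q = A
    · by_cases hqk : G.priority q = k
      -- Some successor lies outside the opponent's region, for otherwise `q` would lie in it.
      · by_contra! hcon
        refine hq.1 (mem_winningRegion_of_forall fun r e => ?_)
        by_contra hr
        exact ((hcon r e).2.2 fun _ => hr).1 hqk
      · exact ⟨σ q, (cut_edge hq.1 hqk).1 (hσ q), fun _ _ => ⟨fun h => absurd h hqk, fun _ => rfl⟩⟩
    · obtain ⟨r, hr⟩ := G.exists_edge q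
      exact ⟨r, hr, fun h1 h2 => absurd ⟨h1, h2⟩ hq⟩
  choose τ hτ hτ' using hτ
  refine ⟨τ, hτ, fun f h0 hf => ?_⟩
  have hL : ∀ n, f n ∉ G.winningRegion A.other := by
    intro n
    induction n with
    | zero => rwa [h0]
    | succ n ih =>
      by_cases ho : G.owner (f n) = A
      · obtain ⟨h1, h2⟩ := hτ' _ ih ho
        rw [← (hf n).2 ho] at h1 h2
        by_cases hfk : G.priority (f n) = k
        · exact h1 hfk
        · exact WinsFrom.not_mem_cut ((hW _ (hcut _ ih)).step ((cut_edge ih hfk).2 (hf n).1)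
            fun _ => h2 hfk) hσ
      · exact fun h => ih (mem_winningRegion_of_edge (Player.eq_other_of_ne ho) (hf n).1 h)
  by_cases hfr : ∃ᶠ n in atTop, G.priority (f n) = k
  · exact ⟨k, hA, hfr, .of_forall fun n => hk _⟩
  · rw [not_frequently, eventually_atTop] at hfr
    obtain ⟨m, hm⟩ := hfr
    have hm' : ∀ n, G.priority (f (n + m)) ≠ k := fun n => hm _ (Nat.le_add_left m n)
    refine (wonBy_shift f m).1 ((wonBy_cut (fun n => hL (n + m)) hm').1
      (hW _ (hcut _ (hL m)) _ (by simp) (IsPlay.cut (fun n => hL (n + m)) hm'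
        (fun n => (hf.shift m n).1) fun n ho => ?_)))
    refine ((hf.shift m n).2 ho).trans ?_
    exact (hτ' _ (hL _) ho).2 (hm' n)

/-- Positional determinacy of parity games with finitely many priorities. -/
theorem determined (n : ℕ) (G : ParityGame P) (hn : ∀ p, G.priority p < n + 2)
    (hsink : ∀ p, G.priority p < 2 → ∀ q, G.edge p q → q = p) (p : P) :
    ∃ A, p ∈ G.winningRegion A := by
  induction n generalizing G p with
  | zero =>
    -- All priorities are below `2`, so every position is a sink and every play is constant.
    choose σ hσ using G.exists_edge
    refine ⟨favours (G.priority p), σ, hσ, fun f h0 hf => ?_⟩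
    have : ∀ n, f n = p := by
      intro n
      induction n with
      | zero => exact h0
      | succ n ih => rw [hsink _ (hn _) _ (hf n).1, ih]
    exact ⟨G.priority p, rfl, Frequently.of_forall fun n => by rw [this],
      .of_forall fun n => (congrArg _ (this n)).le⟩
  | succ n ih =>
    set A := favours (n + 2) with hA
    by_cases hp : p ∈ G.winningRegion A.other
    · exact ⟨_, hp⟩
    refine ⟨A, mem_winningRegion_of_cut hA.symm (fun q => Nat.le_of_lt_succ (hn q))
      (fun q hq => ?_) hp⟩
    -- The new sinks have priority `0` or `1`, so the cut removes `n + 2` without adding a priority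
    -- to the induction.
    have hH (r : P) : (G.cut A (G.winningRegion A.other) (n + 2)).priority r < n + 2 := by
      have h1 := code_lt_two A
      have h2 := code_lt_two A.other
      have h3 := hn r
      simp only [ParityGame.cut]
      split_ifs <;> omega
    have hH' (r : P) (hr : (G.cut A (G.winningRegion A.other) (n + 2)).priority r < 2) (s : P)
        (hs : (G.cut A (G.winningRegion A.other) (n + 2)).edge r s) : s = r := by
      by_cases h : r ∈ G.winningRegion A.other ∨ G.priority r = n + 2
      · simpa [ParityGame.cut, h] using hs
      · rw [not_or] at h
        rw [cut_priority h.1 h.2] at hr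
        exact hsink r hr s ((cut_edge h.1 h.2).1 hs)
    obtain ⟨B, hB⟩ := ih _ hH hH' q
    rcases eq_or_ne B A with hBA | hBA
    · rwa [hBA] at hB
    · rw [Player.eq_other_of_ne hBA] at hB
      exact absurd (winningRegion_cut_other_subset hB) hq

end ParityGame
end ConstructiveMu

/-! ### Subformulas, binders and occurrences -/

namespace ConstructiveMu
namespace Formula

variable {Atom Var : Type*}

/-- The number of connectives and leaves of a formula. -/
def size : Formula Atom Var → ℕ
  | atom _ => 1
  | var _ => 1
  | bot => 1
  | top => 1
  | neg φ => size φ + 1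
  | conj φ ψ => size φ + size ψ + 1
  | disj φ ψ => size φ + size ψ + 1
  | impl φ ψ => size φ + size ψ + 1
  | box φ => size φ + 1
  | dia φ => size φ + 1
  | fix _ _ φ => size φ + 1

theorem size_pos (φ : Formula Atom Var) : 0 < φ.size := by cases φ <;> simp [size]

theorem mem_sub_self (φ : Formula Atom Var) : φ ∈ φ.sub := by cases φ <;> simp [sub]

theorem sub_subset {φ ψ : Formula Atom Var} (h : ψ ∈ φ.sub) : ψ.sub ⊆ φ.sub := by
  induction φ <;> simp only [sub, Set.mem_insert_iff, Set.mem_union, Set.mem_singleton_iff] at h <;>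
    grind [sub]

theorem eq_or_size_lt_of_mem_sub {φ ψ : Formula Atom Var} (h : ψ ∈ φ.sub) :
    ψ = φ ∨ ψ.size < φ.size := by
  induction φ <;> simp only [sub, Set.mem_insert_iff, Set.mem_union, Set.mem_singleton_iff] at h <;>
    grind [size]

theorem size_le_of_mem_sub {φ ψ : Formula Atom Var} (h : ψ ∈ φ.sub) : ψ.size ≤ φ.size := by
  rcases eq_or_size_lt_of_mem_sub h with rfl | h
  · exact le_rfl
  · exact h.le

theorem boundIn_of_not_freeIn {X : Var} {φ : Formula Atom Var} (h : var X ∈ φ.sub)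
    (hf : ¬ φ.FreeIn X) : φ.BoundIn X := by
  induction φ <;> simp only [sub, Set.mem_insert_iff, Set.mem_union, Set.mem_singleton_iff,
    reduceCtorEq, false_or, var.injEq] at h <;> simp only [BoundIn, FreeIn] at * <;> grind [sub]

theorem occ_pos {X : Var} {φ : Formula Atom Var} (h : var X ∈ φ.sub) : 0 < φ.occ X := by
  induction φ <;> simp only [sub, Set.mem_insert_iff, Set.mem_union, Set.mem_singleton_iff,
    reduceCtorEq, false_or, var.injEq] at h <;> simp only [occ] <;> grind

theorem binders_pos {X : Var} {η : FixOp} {ψ φ : Formula Atom Var} (h : fix η X ψ ∈ φ.sub) :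
    0 < φ.binders X := by
  induction φ <;> simp only [sub, Set.mem_insert_iff, Set.mem_union, Set.mem_singleton_iff,
    reduceCtorEq, false_or, fix.injEq] at h <;> simp only [binders] <;> grind

theorem fix_unique {X : Var} {η η' : FixOp} {ψ ψ' φ : Formula Atom Var}
    (h : fix η X ψ ∈ φ.sub) (h' : fix η' X ψ' ∈ φ.sub) (hb : φ.binders X ≤ 1) :
    fix η X ψ = fix η' X ψ' := by
  induction φ <;> simp only [sub, Set.mem_insert_iff, Set.mem_union, Set.mem_singleton_iff,
    reduceCtorEq, false_or] at h h' <;> simp only [binders] at hb <;> grind [binders_pos]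

/-- Two subformulas which share the only occurrence of a variable are nested. -/
theorem nested_of_occ_le_one {X : Var} {χ χ' φ : Formula Atom Var} (h : χ ∈ φ.sub)
    (h' : χ' ∈ φ.sub) (hX : var X ∈ χ.sub) (hX' : var X ∈ χ'.sub) (ho : φ.occ X ≤ 1) :
    χ ∈ χ'.sub ∨ χ' ∈ χ.sub := by
  -- If `χ` and `χ'` lay in different arguments of a binary connective, `X` would occur twice.
  have key {α β : Formula Atom Var} (hα : χ ∈ α.sub) (hβ : χ' ∈ β.sub) :
      2 ≤ α.occ X + β.occ X :=
    Nat.add_le_add (occ_pos (sub_subset hα hX)) (occ_pos (sub_subset hβ hX'))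
  have h₀ := h
  have h₀' := h'
  induction φ <;> simp only [sub, Set.mem_insert_iff, Set.mem_union, Set.mem_singleton_iff] at h h' <;>
    simp only [occ] at ho <;> grind

end Formula
end ConstructiveMu

/-! ### The evaluation game as a parity game -/

namespace ConstructiveMu

open ParityGame

namespace Formula

variable {Atom Var : Type*}

theorem WellBounded.binder_spec {φ : Formula Atom Var} (hφ : φ.WellBounded) {X : Var}
    (h : var X ∈ φ.sub) (hf : ¬ φ.FreeIn X) : φ.occ X ≤ 1 ∧ φ.binders X ≤ 1 ∧
      ∀ η ψ, fix η X ψ ∈ φ.sub → var X ∈ ψ.sub := by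
  have hb := boundIn_of_not_freeIn h hf
  obtain ⟨h1, h2⟩ := hφ X hb
  obtain ⟨η, ψ, h3, h4⟩ := hb
  refine ⟨h1.le, h2.le, fun η' ψ' h' => ?_⟩
  have := fix_unique h3 h' h2.le
  rw [fix.injEq] at this
  rwa [← this.2.2]

end Formula

namespace Position

variable {Atom Var W : Type*}

/-- The subformula of the initial formula which a position stands for. -/
def content : Position Atom Var W → Formula Atom Var
  | main _ ψ _ => ψ
  | dia _ ψ _ => .dia ψ
  | box _ ψ _ => .box ψ
  | ask _ θ θ' _ => .impl θ θ'

/-- A measure which is decreased by all moves but regenerations. -/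
def rank : Position Atom Var W → ℕ
  -- Doubling the size leaves room for an auxiliary position between a formula and its arguments.
  | main _ ψ _ => 2 * ψ.size + 1
  | dia _ ψ _ => 2 * ψ.size + 2
  | box _ ψ _ => 2 * ψ.size + 2
  | ask _ θ θ' _ => 2 * θ.size + 2 * θ'.size + 2

/-- The move from `p` to `q` regenerates `χ`. -/
def Regenerates (p q : Position Atom Var W) (χ : Formula Atom Var) : Prop :=
  ∃ v Q η X ψ, χ = Formula.fix η X ψ ∧ p = main v (.var X) Q ∧ q = main v χ Q

theorem Regenerates.content_eq {p q : Position Atom Var W} {χ : Formula Atom Var}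
    (h : Regenerates p q χ) : q.content = χ := by
  obtain ⟨v, Q, η, X, ψ, -, -, rfl⟩ := h
  rfl

end Position

namespace EvalGame

variable {Atom Var W : Type*} (G : EvalGame Atom Var W)

theorem isPosition_iff (p : Position Atom Var W) :
    G.IsPosition p ↔ p.content ∈ G.formula.sub := by cases p <;> rfl

variable {G} in
theorem Move.descends_or_regenerates {p q : Position Atom Var W} (h : G.Move p q) :
    (q.content ∈ p.content.sub ∧ q.rank < p.rank) ∨
      ∃ χ ∈ G.formula.sub, p.Regenerates q χ := by
  cases h
  case regenerate v η X ψ Q _ _ hX => exact .inr ⟨_, hX, v, Q, η, X, ψ, rfl, rfl, rfl⟩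
  all_goals
    left
    simp only [Position.content, Position.rank, Formula.size, Formula.sub, Set.mem_insert_iff,
      Set.mem_union, Formula.mem_sub_self, true_or, or_true, true_and]
    omega

variable {G} in
theorem Move.isPosition {p q : Position Atom Var W} (h : G.Move p q) (hp : G.IsPosition p) :
    G.IsPosition q := by
  rw [isPosition_iff] at *
  rcases h.descends_or_regenerates with h | ⟨χ, hχ, h⟩
  · exact Formula.sub_subset hp h.1
  · rwa [h.content_eq]

variable {G} in
theorem Move.of_regenerates {p q : Position Atom Var W} {χ : Formula Atom Var} (h : G.Move p q)
    (hr : p.Regenerates q χ) (hp : G.IsPosition p) (hb : G.formula.WellBounded) :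
    ∃ v Q η X ψ, χ = .fix η X ψ ∧ p = .main v (.var X) Q ∧ χ ∈ G.formula.sub ∧
      G.formula.occ X ≤ 1 ∧ G.formula.binders X ≤ 1 ∧ .var X ∈ χ.sub := by
  obtain ⟨v, Q, η, X, ψ, rfl, rfl, rfl⟩ := hr
  rcases h with _ | _
  rename_i hf hX
  obtain ⟨h1, h2, h3⟩ := hb.binder_spec hp hf
  exact ⟨v, Q, η, X, ψ, rfl, rfl, hX, h1, h2, .inr (h3 _ _ hX)⟩

open Classical in
/-- The priority given to the regeneration of a fixed-point formula. -/
noncomputable def fixPriority (χ : Formula Atom Var) : ℕ :=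
  -- Size dominates and the last bit records the owner; as sizes are positive, the value exceeds the
  -- neutral priority `2`.
  2 * χ.size + 2 + code (if G.OwnsFix .I χ then .I else .II)

theorem favours_fixPriority {A : Player} {χ : Formula Atom Var} :
    favours (G.fixPriority χ) = A ↔ G.OwnsFix A χ := by
  have hII : G.OwnsFix .II χ ↔ ¬ G.OwnsFix .I χ := Iff.rfl
  have h0 : (2 * χ.size + 2) % 2 = 0 := by omega
  have h1 : ¬ (2 * χ.size + 3) % 2 = 0 := by omega
  by_cases h : G.OwnsFix .I χ <;> cases A <;> simp [fixPriority, favours, code, h, h0, h1, hII]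

open Classical in
/-- The priority of a position. Priorities below `2` are those of the dead ends. -/
noncomputable def priority (p : Position Atom Var W) : ℕ :=
  if ∃ q, G.Move p q then
    if h : ∃ χ v Q η X ψ, χ = Formula.fix η X ψ ∧ p = .main v (.var X) Q ∧ χ ∈ G.formula.sub
    -- From a bound variable the only possible move is a regeneration, so the priority can sit on
    -- the position. Under well-boundedness the choice is forced, the binder being unique.
    then G.fixPriority h.choose else 2
  else code (G.owner p).other

theorem fixPriority_bounds (χ : Formula Atom Var) :
    2 * χ.size + 2 ≤ G.fixPriority χ ∧ G.fixPriority χ ≤ 2 * χ.size + 3 := by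
  unfold fixPriority
  have := code_lt_two (open Classical in if G.OwnsFix .I χ then .I else .II)
  omega

theorem priority_lt (p : Position Atom Var W) : G.priority p < 2 * G.formula.size + 2 + 2 := by
  unfold priority
  split_ifs with h1 h2
  · obtain ⟨-, -, -, -, -, -, -, h⟩ := h2.choose_spec
    have := Formula.size_le_of_mem_sub h
    have := (G.fixPriority_bounds h2.choose).2
    omega
  · omega
  · have := code_lt_two (G.owner p).other
    omega

theorem two_le_priority {p q : Position Atom Var W} (h : G.Move p q) : 2 ≤ G.priority p := by
  unfold priority
  rw [if_pos ⟨q, h⟩]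
  split_ifs with h2
  · have := (G.fixPriority_bounds h2.choose).1
    omega
  · exact le_rfl

theorem priority_of_dead {p : Position Atom Var W} (h : ∀ q, ¬ G.Move p q) :
    G.priority p = code (G.owner p).other := by simp [priority, h]

variable {G} in
theorem Move.priority_eq {p q : Position Atom Var W} {χ : Formula Atom Var} (h : G.Move p q)
    (hr : p.Regenerates q χ) (hp : G.IsPosition p) (hb : G.formula.WellBounded) :
    G.priority p = G.fixPriority χ := by
  obtain ⟨v, Q, η, X, ψ, rfl, rfl, hX, -, h2, -⟩ := h.of_regenerates hr hp hb
  have hex : ∃ χ v' Q' η X' ψ, χ = Formula.fix η X' ψ ∧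
      (Position.main v (.var X) Q : Position Atom Var W) = .main v' (.var X') Q' ∧
        χ ∈ G.formula.sub := ⟨_, v, Q, η, X, ψ, rfl, rfl, hX⟩
  rw [priority, if_pos ⟨q, h⟩, dif_pos hex]
  obtain ⟨v', Q', η', X', ψ', e1, e2, e3⟩ := hex.choose_spec
  obtain rfl : X = X' := by
    simpa [Position.content] using congrArg Position.content e2
  rw [e1] at e3 ⊢
  rw [Formula.fix_unique hX e3 h2]

variable {G} in
theorem Move.exists_regenerates {p q : Position Atom Var W} (h : G.Move p q)
    (hp : 2 < G.priority p) : ∃ χ, p.Regenerates q χ := by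
  unfold priority at hp
  rw [if_pos ⟨q, h⟩] at hp
  split_ifs at hp with h'
  · obtain ⟨-, v, Q, -, X, -, -, rfl, -⟩ := h'
    rcases h with _ | _
    exact ⟨_, v, Q, _, X, _, rfl, rfl, rfl⟩
  · omega

/-- The evaluation game as a parity game; dead ends become sinks. -/
noncomputable def toParityGame : ParityGame (Position Atom Var W) where
  edge p q := G.Move p q ∨ (∀ r, ¬ G.Move p r) ∧ q = p
  owner := G.owner
  priority := G.priority
  exists_edge p := by
    by_cases h : ∃ q, G.Move p q
    · exact h.imp fun _ => .inl
    · exact ⟨p, .inr ⟨not_exists.1 h, rfl⟩⟩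

/-! ### Infinite runs and the outermost regenerated formula -/

variable {G}

theorem isPosition_run {ρ : ℕ → Position Atom Var W} (h0 : ρ 0 = G.init)
    (hm : ∀ n, G.Move (ρ n) (ρ (n + 1))) (n : ℕ) : G.IsPosition (ρ n) := by
  induction n with
  | zero => rw [h0]; exact Formula.mem_sub_self _
  | succ n ih => exact (hm n).isPosition ih

/-- Without regenerations from `m` on, the rank would decrease forever. -/
theorem exists_regeneration {ρ : ℕ → Position Atom Var W}
    (hm : ∀ n, G.Move (ρ n) (ρ (n + 1))) (m : ℕ) : ∃ n ≥ m, ∃ χ, RegeneratedAt ρ n χ := by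
  by_contra! h
  refine not_strictAnti_of_wellFoundedLT (fun n => (ρ (n + m)).rank)
    (strictAnti_nat_of_succ_lt fun n => ?_)
  rw [add_right_comm]
  rcases (hm (n + m)).descends_or_regenerates with h' | ⟨χ, -, h'⟩
  · exact h'.2
  · exact absurd h' (h _ (Nat.le_add_left m n) χ)

theorem exists_outermost (hb : G.formula.WellBounded) {ρ : ℕ → Position Atom Var W}
    (h0 : ρ 0 = G.init) (hm : ∀ n, G.Move (ρ n) (ρ (n + 1))) {k : ℕ}
    (hfr : ∃ᶠ n in atTop, G.priority (ρ n) = k) (hev : ∀ᶠ n in atTop, G.priority (ρ n) ≤ k) :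
    ∃ χ, Outermost ρ χ ∧ k = G.fixPriority χ := by
  have hpos := isPosition_run h0 hm
  have hprio {n : ℕ} {χ : Formula Atom Var} (h : RegeneratedAt ρ n χ) :
      G.priority (ρ n) = G.fixPriority χ := (hm n).priority_eq h (hpos n) hb
  obtain ⟨m, hle⟩ := eventually_atTop.1 hev
  rw [frequently_atTop] at hfr
  have hk : 2 < k := by
    obtain ⟨n, hn, χ, hχ⟩ := exists_regeneration hm m
    have h1 := hle n hn
    rw [hprio hχ] at h1
    have := (G.fixPriority_bounds χ).1
    have := χ.size_pos
    omega
  obtain ⟨t, ht, hpt⟩ := hfr m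
  obtain ⟨χ, hχ⟩ := (hm t).exists_regenerates (hpt ▸ hk)
  have hkχ : k = G.fixPriority χ := hpt.symm.trans (hprio hχ)
  -- After `χ` is regenerated at `t`, the run stays inside `χ`. Leaving it would regenerate a `χ'`
  -- sharing its variable with `χ`, hence nested with `χ` and strictly larger; its priority would
  -- then exceed `k`.
  have hinv : ∀ n, t < n → (ρ n).content ∈ χ.sub := by
    intro n hn
    induction n, hn using Nat.le_induction with
    | base => rw [hχ.content_eq]; exact Formula.mem_sub_self _
    | succ n hn ih =>
      rcases (hm n).descends_or_regenerates with h | ⟨χ', -, h⟩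
      · exact Formula.sub_subset ih h.1
      · rw [h.content_eq]
        obtain ⟨v, Q, η, X, ψ, -, hX, h1, h2, -, h3⟩ := (hm n).of_regenerates h (hpos n) hb
        rw [hX] at ih
        have hχG : χ ∈ G.formula.sub := by
          rw [← hχ.content_eq]; exact (G.isPosition_iff _).1 (hpos _)
        rcases Formula.nested_of_occ_le_one hχG h1 ih h3 h2 with h' | h'
        · rcases Formula.eq_or_size_lt_of_mem_sub h' with h' | h'
          · rw [h']; exact Formula.mem_sub_self _
          · have h4 := hle n (by omega)
            rw [hprio h, hkχ] at h4
            have := (G.fixPriority_bounds χ').1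
            have := (G.fixPriority_bounds χ).2
            omega
        · exact h'
  refine ⟨χ, ⟨frequently_atTop.2 fun a => ?_, fun χ' hχ' => ?_⟩, hkχ⟩
  -- A later occurrence of priority `k` regenerates a subformula of `χ`; a proper one is smaller and
  -- has a smaller priority, so it is `χ` itself.
  · obtain ⟨b, hb1, hb2⟩ := hfr (max a (t + 1))
    obtain ⟨χ', hχ'⟩ := (hm b).exists_regenerates (hb2 ▸ hk)
    refine ⟨b, le_of_max_le_left hb1, ?_⟩
    have h1 := hinv (b + 1) (by omega)
    rw [hχ'.content_eq] at h1
    rcases Formula.eq_or_size_lt_of_mem_sub h1 with h' | h'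
    · exact h' ▸ hχ'
    · rw [hprio hχ', hkχ] at hb2
      have := (G.fixPriority_bounds χ').2
      have := (G.fixPriority_bounds χ).1
      omega
  · obtain ⟨n, hn, h⟩ := frequently_atTop.1 hχ' (t + 1)
    have h1 := hinv (n + 1) (by omega)
    rwa [Position.Regenerates.content_eq h] at h1

theorem hasPositionalWinningStrategy_of_mem (hb : G.formula.WellBounded) {A : Player}
    (h : G.init ∈ G.toParityGame.winningRegion A) : G.HasPositionalWinningStrategy A := by
  obtain ⟨σ, hσ, hW⟩ := h
  refine ⟨σ, fun p _ _ ⟨q, hq⟩ => (hσ p).resolve_right fun h => h.1 q hq, fun ρ N hρ hf => ?_⟩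
  obtain ⟨h0, hm, hlast⟩ := hρ
  induction N using ENat.recTopCoe with
  | top =>
    have hm' := fun n => hm n (ENat.natCast_lt_top n)
    obtain ⟨k, hk, hfr, hev⟩ := hW ρ h0 fun n => ⟨.inl (hm' n), hf n (ENat.natCast_lt_top n)⟩
    obtain ⟨χ, hχ, rfl⟩ := exists_outermost hb h0 hm' hfr hev
    exact .inr ⟨rfl, χ, hχ, G.favours_fixPriority.1 hk⟩
  | coe n =>
    -- A finite run stays among the positions where `σ` wins, so its last position is a sink
    -- favouring `A`.
    have hw : ∀ i ≤ n, G.toParityGame.WinsFrom A σ (ρ i) := by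
      intro i hi
      induction i with
      | zero => rwa [h0]
      | succ i ih =>
        have hi' : (i : ℕ∞) < n := Nat.cast_lt.2 hi
        exact (ih (by omega)).step (.inl (hm i hi')) (hf i hi')
    have hdead := hlast n rfl
    have := (hw n le_rfl).favours_of_sink hσ fun q hq =>
      (hq.resolve_left (hdead q)).2
    rw [show G.toParityGame.priority (ρ n) = _ from G.priority_of_dead hdead,
      favours_code] at this
    refine .inl ⟨n, rfl, ?_⟩
    rw [← this]
    cases G.owner (ρ n) <;> rfl

variable (G) in
theorem exists_hasPositionalWinningStrategy (hb : G.formula.WellBounded) :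
    ∃ A, G.HasPositionalWinningStrategy A := by
  obtain ⟨A, hA⟩ := ParityGame.determined (2 * G.formula.size + 2) G.toParityGame
    G.priority_lt (fun p hp q hq => (hq.resolve_left fun h =>
      absurd (G.two_le_priority h) (not_le.2 hp)).2) G.init
  exact ⟨A, hasPositionalWinningStrategy_of_mem hb hA⟩

/-! ### At most one player wins -/

theorem Outermost.unique {ρ : ℕ → Position Atom Var W} {χ χ' : Formula Atom Var}
    (h : Outermost ρ χ) (h' : Outermost ρ χ') : χ = χ' := by
  rcases Formula.eq_or_size_lt_of_mem_sub (h.2 _ h'.1) with e | e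
  · exact e.symm
  · exact absurd (Formula.size_le_of_mem_sub (h'.2 _ h.1)) (not_le.2 e)

theorem not_wins_other {A : Player} {ρ : ℕ → Position Atom Var W} {N : ℕ∞}
    (h : G.Wins A ρ N) : ¬ G.Wins A.other ρ N := by
  rintro h'
  rcases h with ⟨n, rfl, h⟩ | ⟨rfl, χ, hχ, h⟩ <;> rcases h' with ⟨n', e, h'⟩ | ⟨e, χ', hχ', h'⟩
  · rw [Nat.cast_inj] at e
    subst e
    exact Player.other_ne _ (h'.symm.trans h)
  · exact ENat.natCast_ne_top n e
  · exact ENat.natCast_ne_top n' e.symm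
  · rw [hχ.unique hχ'] at h
    rw [← G.favours_fixPriority] at h h'
    exact Player.other_ne _ (h'.symm.trans h)

/-- Each position has one owner, so the two strategies merge into a single map; its iteration from
the initial position, stopped at the first dead end if there is one, is the run. -/
theorem exists_run_follows {A : Player} {σ τ : Position Atom Var W → Position Atom Var W}
    (hσ : G.IsStrategy A σ) (hτ : G.IsStrategy A.other τ) :
    ∃ ρ N, G.IsRun ρ N ∧ G.Follows A σ ρ N ∧ G.Follows A.other τ ρ N := by
  classical
  let s : Position Atom Var W → Position Atom Var W := fun p => if G.owner p = A then σ p else τ p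
  have hs {p : Position Atom Var W} (hp : G.IsPosition p) (h : ∃ q, G.Move p q) :
      G.Move p (s p) := by
    by_cases ho : G.owner p = A
    · simpa [s, ho] using hσ p hp ho h
    · simpa [s, ho] using hτ p hp (Player.eq_other_of_ne ho) h
  let ρ : ℕ → Position Atom Var W := fun n => s^[n] G.init
  have hsucc (n : ℕ) : ρ (n + 1) = s (ρ n) := Function.iterate_succ_apply' s n _
  have hmove (n : ℕ) (h : ∀ i ≤ n, ∃ q, G.Move (ρ i) q) :
      G.IsPosition (ρ n) ∧ G.Move (ρ n) (ρ (n + 1)) := by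
    induction n with
    | zero =>
      have : G.IsPosition (ρ 0) := Formula.mem_sub_self _
      exact ⟨this, hsucc 0 ▸ hs this (h 0 le_rfl)⟩
    | succ n ih =>
      obtain ⟨h1, h2⟩ := ih fun i hi => h i (by omega)
      exact ⟨h2.isPosition h1, hsucc (n + 1) ▸ hs (h2.isPosition h1) (h _ le_rfl)⟩
  have hfσ (N : ℕ∞) : G.Follows A σ ρ N := fun n _ ho => by rw [hsucc]; simp [s, ho]
  have hfτ (N : ℕ∞) : G.Follows A.other τ ρ N := fun n _ ho => by
    rw [hsucc]; simp [s, ho, A.other_ne]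
  by_cases hd : ∃ n, ∀ q, ¬ G.Move (ρ n) q
  · refine ⟨ρ, (Nat.find hd : ℕ), ⟨rfl, fun n hn => (hmove n fun i hi => ?_).2, ?_⟩, hfσ _, hfτ _⟩
    · have := Nat.find_min hd (hi.trans_lt (Nat.cast_lt.1 hn))
      push Not at this
      exact this
    · intro n hn
      rw [← Nat.cast_inj.1 hn]
      exact Nat.find_spec hd
  · push Not at hd
    exact ⟨ρ, ⊤, ⟨rfl, fun n _ => (hmove n fun i _ => hd i).2, fun n hn =>
      absurd hn.symm (ENat.natCast_ne_top n)⟩, hfσ _, hfτ _⟩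

theorem not_hasPositionalWinningStrategy_other {A : Player}
    (h : G.HasPositionalWinningStrategy A) : ¬ G.HasPositionalWinningStrategy A.other := by
  rintro ⟨τ, hτ, hτ'⟩
  obtain ⟨σ, hσ, hσ'⟩ := h
  obtain ⟨ρ, N, hρ, h1, h2⟩ := exists_run_follows hσ hτ
  exact not_wins_other (hσ' ρ N hρ h1) (hτ' ρ N hρ h2)

end EvalGame
end ConstructiveMu

theorem mainTheorem2 {Atom Var W : Type*} (M : ConstructiveMu.CKModel Atom W)
    (U : Var → Set W) (w : W) (φ : ConstructiveMu.Formula Atom Var)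
    (hφ : φ.WellFormed) (hn : φ.WellNamed) :
    ∃! A : ConstructiveMu.Player,
      (ConstructiveMu.EvalGame.mk M U w φ).HasPositionalWinningStrategy A := by
  obtain ⟨A, hA⟩ :=
    (ConstructiveMu.EvalGame.mk M U w φ).exists_hasPositionalWinningStrategy hn.2
  refine ⟨A, hA, fun B hB => ?_⟩
  by_contra hne
  rw [ConstructiveMu.Player.eq_other_of_ne hne] at hB
  exact ConstructiveMu.EvalGame.not_hasPositionalWinningStrategy_other hA hB
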